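/- Let $M,N\ge 0$ be integers, $\omega_1,\dots,\omega_M\in\mathbb R$, and let $t_1,\dots,t_N$ be independent real random variables with a common probability density $p_T$ that vanishes outside $[0,T]$. Let $\Psi_N\in\mathbb C^{N\times(2M+1)}$ be the matrix whose $k$-th row is $$\bigl(1,\ e^{j\omega_1t_k},\ e^{-j\omega_1t_k},\ \dots,\ e^{j\omega_Mt_k},\ e^{-j\omega_Mt_k}\bigr),$$ let $\psi_k$ be the conjugate transpose of this row, and put $R_N=\Psi_N^{\mathsf H}\Psi_N=\sum_{k=1}^N\psi_k\psi_k^{\mathsf H}$, $R_0=\mathbb E[R_N]$ and $X_k=\psi_k\psi_k^{\mathsf H}-\mathbb E[\psi_k\psi_k^{\mathsf H}]$. Write $\|\cdot\|$ for the spectral norm. Then: 1. $\|X_k\|\le 2(2M+1)$ almost surely for every $k$, and $\bigl\|\sum_{k=1}^N\mathbb E[X_k^2]\bigr\|\le 4N(2M+1)^2$. 2. Let $R,v\in\mathbb R$ be such that $\|X_k\|\le R$ almost surely for every $k$ and $\bigl\|\sum_{k=1}^N\mathbb E[X_k^2]\bigr\|\le v$ (by 1., $R=2(2M+1)$ and $v=4N(2M+1)^2$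 are admissible). Let $t\in(0,\lambda_{\min}(R_0))$ and $\delta$ satisfy $$(2M+1)\exp\!\left(-\frac{t^2/2}{v+Rt/3}\right)=\delta$$ (in the degenerate case $v=R=0$ the fraction is read as $0$). Then, with probability at least $1-\delta$, $R_N$ is positive definite and $$R_N^{-1}\preceq\frac{1}{\lambda_{\min}(R_0)-t}\,I_{2M+1}.$$ -/

import Mathlib

open MeasureTheory ProbabilityTheory
open scoped Matrix Matrix.Norms.L2Operator ComplexOrder

noncomputable section

/-- `p` is a probability density on the real line that vanishes outside `[0, T]`. -/
structure IsSamplingDensity (T : ℝ) (p : ℝ → ℝ) : Prop where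
  measurable : Measurable p
  nonneg : ∀ s, 0 ≤ p s
  eq_zero_of_notMem : ∀ s, s ∉ Set.Icc 0 T → p s = 0
  lintegral_eq_one : ∫⁻ s, ENNReal.ofReal (p s) = 1

/-- The probability law on the real line with density `p`. -/
def densityLaw (p : ℝ → ℝ) : Measure ℝ :=
  volume.withDensity fun s => ENNReal.ofReal (p s)

/-- The list `0, ω₁, -ω₁, …, ω_M, -ω_M` of excited frequencies (`ω₁` is `ω 0`). -/
def excitedFreq {M : ℕ} (ω : Fin M → ℝ) (l : Fin (2 * M + 1)) : ℝ :=
  if h : (l : ℕ) = 0 then 0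
  else if (l : ℕ) % 2 = 1 then ω ⟨((l : ℕ) - 1) / 2, by omega⟩
  else -ω ⟨((l : ℕ) - 1) / 2, by omega⟩

/-- The `N × (2M+1)` generalized Vandermonde matrix `Ψ_N`, with the rows
`(1, exp(j ω₁ t_k), exp(-j ω₁ t_k), …, exp(j ω_M t_k), exp(-j ω_M t_k))`. -/
def vandermondePsi {M N : ℕ} (ω : Fin M → ℝ) (s : Fin N → ℝ) :
    Matrix (Fin N) (Fin (2 * M + 1)) ℂ :=
  Matrix.of fun k l => Complex.exp (Complex.I * ((excitedFreq ω l * s k : ℝ) : ℂ))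

/-- `R_N = Ψ_Nᴴ Ψ_N`. -/
def gramR {M N : ℕ} (ω : Fin M → ℝ) (s : Fin N → ℝ) :
    Matrix (Fin (2 * M + 1)) (Fin (2 * M + 1)) ℂ :=
  (vandermondePsi ω s)ᴴ * vandermondePsi ω s

/-- Entrywise expectation of a random complex matrix. -/
def matrixExpectation {Ω : Type*} [MeasurableSpace Ω] {m n : Type*} (P : Measure Ω)
    (A : Ω → Matrix m n ℂ) : Matrix m n ℂ :=
  Matrix.of fun i j => ∫ x, A x i j ∂P

/-- `R_0 = E[R_N]` for the random sampling instants `τ 0, …, τ (N-1)`. -/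
def expectedGram {Ω : Type*} [MeasurableSpace Ω] {M N : ℕ} (P : Measure Ω)
    (ω : Fin M → ℝ) (τ : Fin N → Ω → ℝ) : Matrix (Fin (2 * M + 1)) (Fin (2 * M + 1)) ℂ :=
  matrixExpectation P fun x => gramR ω fun k => τ k x

/-- The rank-one matrix `ψ_k ψ_kᴴ`, where `ψ_kᴴ` is the `k`-th row of `Ψ_N`;
the sum of these matrices over `k` is `R_N`. -/
def rankOneTerm {M N : ℕ} (ω : Fin M → ℝ) (s : Fin N → ℝ) (k : Fin N) :
    Matrix (Fin (2 * M + 1)) (Fin (2 * M + 1)) ℂ :=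
  Matrix.vecMulVec (star (vandermondePsi ω s k)) (vandermondePsi ω s k)

/-- The centred summand `X_k = ψ_k ψ_kᴴ - E[ψ_k ψ_kᴴ]`. -/
def centredTerm {Ω : Type*} [MeasurableSpace Ω] {M N : ℕ} (P : Measure Ω)
    (ω : Fin M → ℝ) (τ : Fin N → Ω → ℝ) (k : Fin N) (x : Ω) :
    Matrix (Fin (2 * M + 1)) (Fin (2 * M + 1)) ℂ :=
  rankOneTerm ω (fun i => τ i x) k -
    matrixExpectation P fun y => rankOneTerm ω (fun i => τ i y) k

/-- The matrix variance `‖∑ₖ E[X_k²]‖` (spectral norm). -/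
def matrixVariance {Ω : Type*} [MeasurableSpace Ω] {M N : ℕ} (P : Measure Ω)
    (ω : Fin M → ℝ) (τ : Fin N → Ω → ℝ) : ℝ :=
  ‖∑ k, matrixExpectation P fun x => centredTerm P ω τ k x ^ 2‖

/-- The smallest real eigenvalue of a square matrix; it is applied to Hermitian matrices only,
whose spectrum is real. -/
def lambdaMin {n : Type*} [Fintype n] [DecidableEq n] (A : Matrix n n ℂ) : ℝ :=
  sInf (spectrum ℝ A)

end

/-! Since $R_N=R_0+\sum_k X_k$, the event $\sum_k X_k\succeq -tI$ forces
$R_N\succeq(\lambda_{\min}(R_0)-t)I\succ0$, and inversion reverses the order. What remains is the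
lower tail of matrix Bernstein, `matrix_bernstein_lower_tail`.

The tail bound is a Laplace transform argument in the style of Ahlswede and Winter. By Markov it
suffices to bound $\mathbb E\,\mathrm{tr}\exp(-\theta\sum_k X_k)$. Golden–Thompson splits off one
summand at a time, independence factors the expectation, and each factor is dominated by a scalar:
$\mathbb E e^{-\theta X_k}\preceq\exp(\kappa\theta^2\|\mathbb E X_k^2\|)I$ with
$\kappa=1/(2(1-\theta R/3))$. The exponent then carries $\sum_k\|\mathbb E X_k^2\|$ rather than
$\|\sum_k\mathbb E X_k^2\|$; the two agree for identically distributed samples, so Lieb's concavity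
theorem is not needed.

Golden–Thompson follows from the Lie product formula and a trace inequality for powers $2^k$. The
explicit constants come from the unimodular entries of $\psi_k\psi_k^{\mathsf H}$. -/

/-! ### The Lie product formula. -/

section LieProduct

variable {𝔸 : Type*} [NormedRing 𝔸] [NormOneClass 𝔸]

theorem norm_normedSpaceExp_le [NormedAlgebra ℝ 𝔸] (x : 𝔸) : ‖NormedSpace.exp x‖ ≤ Real.exp ‖x‖ := by
  rw [NormedSpace.exp_eq_tsum ℝ, Real.exp_eq_exp_ℝ, NormedSpace.exp_eq_tsum ℝ]
  refine tsum_of_norm_bounded (NormedSpace.expSeries_summable' (𝕂 := ℝ) ‖x‖).hasSum fun n => ?_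
  rw [norm_smul, smul_eq_mul, Real.norm_of_nonneg (by positivity)]
  gcongr
  exact norm_pow_le x n

/-- Telescoping gives the exponent `n - 1`; `1 ≤ c` rounds it up to `n`, so that the later choice of
`c` makes `c ^ n` independent of `n`. -/
theorem norm_pow_sub_pow_le_of_norm_le {x y : 𝔸} {c : ℝ} (hc : 1 ≤ c) (hx : ‖x‖ ≤ c)
    (hy : ‖y‖ ≤ c) (n : ℕ) : ‖x ^ n - y ^ n‖ ≤ n * c ^ n * ‖x - y‖ := by
  induction n with
  | zero => simp
  | succ n ih =>
    have h : x ^ (n + 1) - y ^ (n + 1) = x * (x ^ n - y ^ n) + (x - y) * y ^ n := by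
      rw [pow_succ' x, pow_succ' y]; noncomm_ring
    have hyn : ‖y ^ n‖ ≤ c ^ n := (norm_pow_le y n).trans (by gcongr)
    have hcn : c ^ n ≤ c ^ (n + 1) := pow_le_pow_right₀ hc n.le_succ
    calc ‖x ^ (n + 1) - y ^ (n + 1)‖
        ≤ ‖x‖ * ‖x ^ n - y ^ n‖ + ‖x - y‖ * ‖y ^ n‖ := by
          rw [h]
          exact (norm_add_le _ _).trans (add_le_add (norm_mul_le _ _) (norm_mul_le _ _))
      _ ≤ c * (n * c ^ n * ‖x - y‖) + ‖x - y‖ * c ^ (n + 1) := by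
          gcongr
          exact hyn.trans hcn
      _ = (n + 1 : ℕ) * c ^ (n + 1) * ‖x - y‖ := by push_cast; ring

/-- The **Lie product formula**. -/
theorem tendsto_exp_mul_exp_pow [NormedAlgebra ℝ 𝔸] [CompleteSpace 𝔸] (a b : 𝔸) :
    Filter.Tendsto (fun n : ℕ => (NormedSpace.exp ((n : ℝ)⁻¹ • a) *
      NormedSpace.exp ((n : ℝ)⁻¹ • b)) ^ n) Filter.atTop (nhds (NormedSpace.exp (a + b))) := by
  let _ : NormedAlgebra ℚ 𝔸 := NormedAlgebra.restrictScalars ℚ ℝ 𝔸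
  let f : ℝ → 𝔸 := fun s => NormedSpace.exp (s • a) * NormedSpace.exp (s • b)
  let g : ℝ → 𝔸 := fun s => NormedSpace.exp (s • (a + b))
  -- `f` and `g` agree to first order at 0, hence `n * ‖f (1/n) - g (1/n)‖ → 0`; telescoping turns
  -- this into convergence of the `n`-th powers.
  have hd : HasDerivAt (fun s => f s - g s) 0 0 := by
    have := ((hasDerivAt_exp_smul_const a (0 : ℝ)).mul (hasDerivAt_exp_smul_const b (0 : ℝ))).sub
      (hasDerivAt_exp_smul_const (a + b) (0 : ℝ))
    refine this.congr_deriv ?_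
    simp
  have hinv : Filter.Tendsto (fun n : ℕ => (n : ℝ)⁻¹) Filter.atTop (nhdsWithin 0 {0}ᶜ) := by
    refine tendsto_nhdsWithin_iff.mpr ⟨tendsto_inv_atTop_nhds_zero_nat, ?_⟩
    filter_upwards [Filter.eventually_gt_atTop 0] with n hn
    simpa using hn.ne'
  have hslope := (hd.tendsto_slope_zero.comp hinv).norm.const_mul (Real.exp (‖a‖ + ‖b‖))
  simp only [norm_zero, mul_zero] at hslope
  rw [tendsto_iff_norm_sub_tendsto_zero]
  refine squeeze_zero' (Filter.Eventually.of_forall fun _ => norm_nonneg _) ?_ hslope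
  filter_upwards [Filter.eventually_gt_atTop 0] with n hn
  have hn' : (0 : ℝ) < n := by exact_mod_cast hn
  set c := Real.exp ((n : ℝ)⁻¹ * (‖a‖ + ‖b‖)) with hcdef
  have hc : 1 ≤ c := Real.one_le_exp (by positivity)
  have hcn : c ^ n = Real.exp (‖a‖ + ‖b‖) := by
    rw [hcdef, ← Real.exp_nat_mul]
    congr 1
    field_simp
  have hf : ‖f (n : ℝ)⁻¹‖ ≤ c := by
    refine (norm_mul_le _ _).trans ?_
    rw [hcdef, mul_add, Real.exp_add]
    have key : ∀ z : 𝔸, ‖NormedSpace.exp ((n : ℝ)⁻¹ • z)‖ ≤ Real.exp ((n : ℝ)⁻¹ * ‖z‖) := by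
      intro z
      refine (norm_normedSpaceExp_le _).trans (le_of_eq ?_)
      rw [norm_smul, Real.norm_of_nonneg (by positivity)]
    exact mul_le_mul (key a) (key b) (norm_nonneg _) (Real.exp_pos _).le
  have hg : ‖g (n : ℝ)⁻¹‖ ≤ c := by
    refine (norm_normedSpaceExp_le _).trans ?_
    rw [norm_smul, Real.norm_of_nonneg (by positivity), hcdef]
    gcongr
    exact norm_add_le _ _
  have hgn : NormedSpace.exp (a + b) = g (n : ℝ)⁻¹ ^ n := by
    change _ = NormedSpace.exp _ ^ n
    rw [← NormedSpace.exp_nsmul, ← Nat.cast_smul_eq_nsmul ℝ, smul_smul,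
      mul_inv_cancel₀ hn'.ne', one_smul]
  have := norm_pow_sub_pow_le_of_norm_le hc hf hg n
  rw [hcn, ← hgn] at this
  refine this.trans (le_of_eq ?_)
  have h0 : f 0 - g 0 = 0 := by simp [f, g]
  simp only [Function.comp, zero_add, h0, sub_zero, norm_smul, inv_inv, Real.norm_natCast]
  ring

end LieProduct

/-! ### Trace inequalities and Golden–Thompson. -/

section TraceInequalities

variable {n : Type*} [Fintype n]

namespace Matrix

theorem trace_mul_pow_comm [DecidableEq n] (A B : Matrix n n ℂ) (k : ℕ) :
    ((A * B) ^ k).trace = ((B * A) ^ k).trace := by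
  cases k with
  | zero => simp
  | succ k =>
    have h : ∀ k : ℕ, (A * B) ^ k * A = A * (B * A) ^ k := by
      intro k
      induction k with
      | zero => simp
      | succ k ih => rw [pow_succ', mul_assoc, ih, pow_succ']; simp only [mul_assoc]
    rw [pow_succ, ← mul_assoc, h, mul_assoc, Matrix.trace_mul_comm, pow_succ, mul_assoc]

theorem re_trace_mul_conjTranspose_self (A : Matrix n n ℂ) :
    (A * Aᴴ).trace.re = ∑ q : n × n, ‖A q.1 q.2‖ ^ 2 := by
  rw [Fintype.sum_prod_type, Matrix.trace, Complex.re_sum]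
  refine Finset.sum_congr rfl fun i _ => ?_
  rw [Matrix.diag_apply, Matrix.mul_apply, Complex.re_sum]
  refine Finset.sum_congr rfl fun j _ => ?_
  rw [Matrix.conjTranspose_apply, ← Complex.normSq_eq_norm_sq]
  simp [Complex.normSq_apply]

theorem norm_trace_mul_le (A B : Matrix n n ℂ) :
    ‖(A * B).trace‖ ≤ √((A * Aᴴ).trace.re) * √((B * Bᴴ).trace.re) := by
  have hB : (B * Bᴴ).trace.re = ∑ q : n × n, ‖B q.2 q.1‖ ^ 2 := by
    rw [re_trace_mul_conjTranspose_self, ← (Equiv.prodComm n n).sum_comp]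
    simp
  rw [hB, re_trace_mul_conjTranspose_self, ← Real.sqrt_mul (by positivity)]
  refine (le_trans ?_ (Real.abs_le_sqrt (Finset.sum_mul_sq_le_sq_mul_sq Finset.univ
    (fun q : n × n => ‖A q.1 q.2‖) (fun q : n × n => ‖B q.2 q.1‖))))
  refine le_trans ?_ (le_abs_self _)
  have : (A * B).trace = ∑ q : n × n, A q.1 q.2 * B q.2 q.1 := by
    rw [Fintype.sum_prod_type]
    simp [Matrix.trace, Matrix.mul_apply]
  rw [this]
  refine (norm_sum_le _ _).trans (le_of_eq ?_)
  simp

theorem PosSemidef.trace_mul_nonneg {A B : Matrix n n ℂ} (hA : A.PosSemidef)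
    (hB : B.PosSemidef) : 0 ≤ (A * B).trace := by
  classical
  open scoped MatrixOrder in
  obtain ⟨C, rfl⟩ := CStarAlgebra.nonneg_iff_eq_star_mul_self.mp hA.nonneg
  rw [Matrix.star_eq_conjTranspose, mul_assoc, Matrix.trace_mul_comm]
  exact (hB.mul_mul_conjTranspose_same C).trace_nonneg

/-- The two bounds feed each other: each at `k + 1` starts from the first at `k` and then, after a
cyclic rearrangement, uses the second at `k`. The base case is Cauchy–Schwarz for the trace form. -/
theorem norm_trace_pow_two_pow_le [DecidableEq n] (k : ℕ) :
    (∀ X : Matrix n n ℂ, ‖(X ^ 2 ^ (k + 1)).trace‖ ≤ ((X * Xᴴ) ^ 2 ^ k).trace.re) ∧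
    ∀ A B : Matrix n n ℂ, A.PosSemidef → B.PosSemidef →
      ‖((A * B) ^ 2 ^ k).trace‖ ≤ (A ^ 2 ^ k * B ^ 2 ^ k).trace.re := by
  induction k with
  | zero =>
    refine ⟨fun X => ?_, fun A B hA hB => ?_⟩
    · have h := norm_trace_mul_le X X
      rw [Real.mul_self_sqrt] at h
      · simpa [sq] using h
      · rw [re_trace_mul_conjTranspose_self]; positivity
    · simp only [pow_zero, pow_one]
      exact (congrArg Complex.re (Complex.norm_of_nonneg' (hA.trace_mul_nonneg hB))).le
  | succ k ih =>
    obtain ⟨hP, hQ⟩ := ih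
    refine ⟨fun X => ?_, fun A B hA hB => ?_⟩
    · set m := 2 ^ k with hm
      have hpow : (2 : ℕ) ^ (k + 1) = m * 2 := by rw [pow_succ]
      have h1 : X ^ 2 ^ (k + 1 + 1) = (X * X) ^ 2 ^ (k + 1) := by
        rw [← sq, ← pow_mul]; congr 1; ring
      have h2 : ((X * X) * (X * X)ᴴ) ^ m = (X * (X * Xᴴ * Xᴴ)) ^ m := by
        rw [Matrix.conjTranspose_mul]; simp only [mul_assoc]
      have hA := Matrix.posSemidef_self_mul_conjTranspose X
      have hB := Matrix.posSemidef_conjTranspose_mul_self X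
      rw [h1]
      refine (hP (X * X)).trans ?_
      rw [h2, trace_mul_pow_comm]
      have h3 : X * Xᴴ * Xᴴ * X = (X * Xᴴ) * (Xᴴ * X) := by simp only [mul_assoc]
      rw [h3]
      refine ((Complex.re_le_norm _).trans (hQ _ _ hA hB)).trans ?_
      -- By Cauchy–Schwarz the bound splits into two square roots, which are equal because
      -- $XX^{\mathsf H}$ and $X^{\mathsf H}X$ have equal power traces.
      refine ((Complex.re_le_norm _).trans (norm_trace_mul_le _ _)).trans ?_
      rw [(hA.isHermitian.pow m).eq, (hB.isHermitian.pow m).eq, ← pow_add, ← pow_add,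
        ← mul_two, ← hpow, trace_mul_pow_comm Xᴴ X, Real.mul_self_sqrt]
      have := (hA.pow (2 ^ (k + 1))).trace_nonneg
      exact (Complex.le_def.mp this).1
    · have hBA : (A * B)ᴴ = B * A := by
        rw [Matrix.conjTranspose_mul, hA.isHermitian.eq, hB.isHermitian.eq]
      refine (hP (A * B)).trans ?_
      have h1 : A * B * (A * B)ᴴ = A * (B * B * A) := by rw [hBA]; simp only [mul_assoc]
      have h2 : B * B * A * A = B ^ 2 * A ^ 2 := by rw [sq, sq]; simp only [mul_assoc]
      rw [h1, trace_mul_pow_comm, h2, trace_mul_pow_comm]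
      refine ((Complex.re_le_norm _).trans (hQ _ _ (hA.pow 2) (hB.pow 2))).trans (le_of_eq ?_)
      rw [← pow_mul, ← pow_mul, ← pow_succ']

theorem IsHermitian.exp_posSemidef [DecidableEq n] {A : Matrix n n ℂ} (hA : A.IsHermitian) :
    (NormedSpace.exp A).PosSemidef := by
  open scoped MatrixOrder in
  rw [← Matrix.nonneg_iff_posSemidef, ← CFC.real_exp_eq_normedSpace_exp hA.isSelfAdjoint]
  exact cfc_nonneg fun x _ => (Real.exp_pos x).le

/-- The **Golden–Thompson inequality**. -/
theorem IsHermitian.re_trace_exp_add_le [DecidableEq n] {A B : Matrix n n ℂ} (hA : A.IsHermitian)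
    (hB : B.IsHermitian) :
    (NormedSpace.exp (A + B)).trace.re ≤ (NormedSpace.exp A * NormedSpace.exp B).trace.re := by
  cases isEmpty_or_nonempty n
  · simp [Matrix.trace]
  let _ : NormedAlgebra ℚ (Matrix n n ℂ) := NormedAlgebra.restrictScalars ℚ ℂ _
  -- The trace inequality covers only powers of two, so the Lie formula is used along the
  -- subsequence $2^k$.
  have htwo : Filter.Tendsto (fun k : ℕ => 2 ^ k) Filter.atTop Filter.atTop :=
    tendsto_pow_atTop_atTop_of_one_lt one_lt_two
  have hlim := ((Continuous.matrix_trace continuous_id).tendsto _).comp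
    ((tendsto_exp_mul_exp_pow A B).comp htwo)
  have hlim' := (Complex.continuous_re.tendsto _).comp hlim
  refine le_of_tendsto hlim' (Filter.Eventually.of_forall fun k => ?_)
  have hs : ∀ {C : Matrix n n ℂ}, C.IsHermitian →
      (NormedSpace.exp (((2 ^ k : ℕ) : ℝ)⁻¹ • C)).PosSemidef ∧
      NormedSpace.exp (((2 ^ k : ℕ) : ℝ)⁻¹ • C) ^ 2 ^ k = NormedSpace.exp C := by
    intro C hC
    refine ⟨IsHermitian.exp_posSemidef ?_, ?_⟩
    · exact ((IsSelfAdjoint.all _).smul hC.isSelfAdjoint).isHermitian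
    · rw [← NormedSpace.exp_nsmul, ← Nat.cast_smul_eq_nsmul ℝ, smul_smul,
        mul_inv_cancel₀ (by positivity), one_smul]
  have := (norm_trace_pow_two_pow_le (n := n) k).2 _ _ (hs hA).1 (hs hB).1
  rw [(hs hA).2, (hs hB).2] at this
  exact (Complex.re_le_norm _).trans this

end Matrix

end TraceInequalities

/-! ### Bounds for the exponential, the Löwner order and the spectral norm. -/

/-- Since $(k+2)!\ge 2\cdot3^k$, the Taylor tail is dominated by a geometric series of ratio `c /
3`. -/
theorem Real.exp_le_one_add_add_sq_div {x c : ℝ} (hx : |x| ≤ c) (hc : c < 3) :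
    Real.exp x ≤ 1 + x + (2 * (1 - c / 3))⁻¹ * x ^ 2 := by
  have hc0 : 0 ≤ c := (abs_nonneg x).trans hx
  have hsum : HasSum (fun k : ℕ => x ^ k / (k.factorial : ℝ)) (Real.exp x) := by
    rw [Real.exp_eq_exp_ℝ]
    exact NormedSpace.expSeries_div_hasSum_exp x
  have htail := (hasSum_nat_add_iff' 2).mpr hsum
  have hgeom := (hasSum_geometric_of_lt_one (div_nonneg hc0 zero_le_three)
    ((div_lt_one zero_lt_three).mpr hc)).mul_left (x ^ 2 / 2)
  have hle := hasSum_le (fun k => ?_) htail hgeom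
  · simp only [Finset.sum_range_succ, Finset.range_zero, Finset.sum_empty] at hle
    norm_num at hle
    have : x ^ 2 / 2 * (1 - c / 3)⁻¹ = (2 * (1 - c / 3))⁻¹ * x ^ 2 := by
      rw [mul_inv]; ring
    linarith
  · have hfac : (2 * 3 ^ k : ℝ) ≤ (k + 2).factorial := by
      have := Nat.factorial_mul_pow_le_factorial (m := 2) (n := k)
      rw [Nat.add_comm 2 k] at this
      exact_mod_cast this
    calc x ^ (k + 2) / ((k + 2).factorial : ℝ)
        ≤ x ^ 2 * c ^ k / ((k + 2).factorial : ℝ) := by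
          have hxk : x ^ k ≤ c ^ k :=
            (le_abs_self _).trans ((abs_pow x k).trans_le (pow_le_pow_left₀ (abs_nonneg x) hx k))
          rw [pow_add, mul_comm]
          gcongr
      _ ≤ x ^ 2 * c ^ k / (2 * 3 ^ k) := by gcongr
      _ = x ^ 2 / 2 * (c / 3) ^ k := by rw [div_pow]; field_simp

namespace Matrix

variable {n : Type*} [Fintype n] [DecidableEq n]

section Order

open scoped MatrixOrder

theorem IsHermitian.trace_cfc {A : Matrix n n ℂ} (hA : A.IsHermitian) (f : ℝ → ℝ) :
    (_root_.cfc f A).trace = ∑ i, (f (hA.eigenvalues i) : ℂ) := by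
  rw [hA.cfc_eq, IsHermitian.cfc, Unitary.conjStarAlgAut_apply, Matrix.trace_mul_cycle]
  simp [Matrix.trace]

theorem IsHermitian.re_trace_exp {A : Matrix n n ℂ} (hA : A.IsHermitian) :
    (NormedSpace.exp A).trace.re = ∑ i, Real.exp (hA.eigenvalues i) := by
  rw [← CFC.real_exp_eq_normedSpace_exp hA.isSelfAdjoint, hA.trace_cfc]
  simp only [← Complex.ofReal_sum, Complex.ofReal_re]

/-- If `tr e^A ≤ e^a` then `A ≤ a`. -/
theorem IsHermitian.posSemidef_smul_one_sub_of_trace_exp_le {A : Matrix n n ℂ}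
    (hA : A.IsHermitian) {a : ℝ} (h : (NormedSpace.exp A).trace.re ≤ Real.exp a) :
    (a • (1 : Matrix n n ℂ) - A).PosSemidef := by
  rw [← Matrix.le_iff, ← Algebra.algebraMap_eq_smul_one,
    le_algebraMap_iff_spectrum_le (ha := hA.isSelfAdjoint)]
  intro x hx
  rw [hA.spectrum_real_eq_range_eigenvalues] at hx
  obtain ⟨i, rfl⟩ := hx
  rw [hA.re_trace_exp] at h
  exact Real.exp_le_exp.mp ((Finset.single_le_sum (f := fun i => Real.exp (hA.eigenvalues i))
    (fun _ _ => (Real.exp_pos _).le) (Finset.mem_univ i)).trans h)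

theorem IsHermitian.posSemidef_one_add_add_sub_exp [Nonempty n] {A : Matrix n n ℂ}
    (hA : A.IsHermitian) {c : ℝ} (hAc : ‖A‖ ≤ c) (hc : c < 3) :
    (1 + A + (2 * (1 - c / 3))⁻¹ • A ^ 2 - NormedSpace.exp A).PosSemidef := by
  have hsa : IsSelfAdjoint A := hA.isSelfAdjoint
  have hpoly : _root_.cfc (fun x : ℝ => 1 + x + (2 * (1 - c / 3))⁻¹ * x ^ 2) A =
      1 + A + (2 * (1 - c / 3))⁻¹ • A ^ 2 := by
    rw [cfc_add (a := A) (fun x : ℝ => 1 + x) (fun x => (2 * (1 - c / 3))⁻¹ * x ^ 2),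
      cfc_const_add (a := A) 1 (fun x : ℝ => x), cfc_id' ℝ A,
      cfc_const_mul (2 * (1 - c / 3))⁻¹ (fun x : ℝ => x ^ 2) A, cfc_pow_id A 2]
    simp
  rw [← Matrix.le_iff, ← CFC.real_exp_eq_normedSpace_exp hsa, ← hpoly]
  refine cfc_mono fun x hx => Real.exp_le_one_add_add_sq_div ?_ hc
  exact (spectrum.norm_le_norm_of_mem hx).trans hAc

theorem IsHermitian.posSemidef_norm_smul_one_sub {A : Matrix n n ℂ} (hA : A.IsHermitian) :
    (‖A‖ • (1 : Matrix n n ℂ) - A).PosSemidef := by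
  rw [← Matrix.le_iff, ← Algebra.algebraMap_eq_smul_one]
  exact hA.isSelfAdjoint.le_algebraMap_norm_self

theorem IsHermitian.posSemidef_sub_lambdaMin_smul_one {A : Matrix n n ℂ} (hA : A.IsHermitian) :
    (A - lambdaMin A • (1 : Matrix n n ℂ)).PosSemidef := by
  rw [← Matrix.le_iff, ← Algebra.algebraMap_eq_smul_one,
    algebraMap_le_iff_le_spectrum (ha := hA.isSelfAdjoint)]
  intro x hx
  -- A real `sInf` is a lower bound only for sets bounded below; here the spectrum is finite.
  refine csInf_le ?_ hx
  rw [hA.spectrum_real_eq_range_eigenvalues]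
  exact (Set.finite_range _).bddBelow

theorem posDef_and_posSemidef_inv_of_posSemidef_sub {A : Matrix n n ℂ} {c : ℝ} (hc : 0 < c)
    (hA : (A - c • (1 : Matrix n n ℂ)).PosSemidef) :
    A.PosDef ∧ (c⁻¹ • (1 : Matrix n n ℂ) - A⁻¹).PosSemidef := by
  have hc1 : (c • (1 : Matrix n n ℂ)).PosDef := PosDef.one.smul hc
  have hpd : A.PosDef := by
    have := hc1.add_posSemidef hA
    rwa [add_sub_cancel] at this
  refine ⟨hpd, ?_⟩
  have hcc : c • (1 : Matrix n n ℂ) * c⁻¹ • 1 = 1 := by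
    rw [smul_mul_smul_comm, mul_inv_cancel₀ hc.ne', one_smul, one_mul]
  have hcc' : c⁻¹ • (1 : Matrix n n ℂ) * c • 1 = 1 := by
    rw [smul_mul_smul_comm, inv_mul_cancel₀ hc.ne', one_smul, one_mul]
  obtain ⟨u, hu⟩ := hpd.isUnit
  let w : (Matrix n n ℂ)ˣ := ⟨c • 1, c⁻¹ • 1, hcc, hcc'⟩
  have := CStarAlgebra.inv_le_inv (a := w) (b := u) hc1.posSemidef.nonneg
    (by rw [hu]; exact Matrix.le_iff.mpr hA)
  rw [Matrix.coe_units_inv, hu, Matrix.le_iff] at this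
  exact this

end Order

/-- Cauchy–Schwarz in each row; this crude bound yields the factors $2M+1$ in the admissible
constants. -/
theorem l2_opNorm_le_card_mul {A : Matrix n n ℂ} {b : ℝ} (hb : 0 ≤ b)
    (hA : ∀ i j, ‖A i j‖ ≤ b) : ‖A‖ ≤ Fintype.card n * b := by
  rw [Matrix.l2_opNorm_def]
  refine ContinuousLinearMap.opNorm_le_bound _ (by positivity) fun x => ?_
  rw [← abs_of_nonneg (show 0 ≤ (Fintype.card n : ℝ) * b * ‖x‖ by positivity),
    ← abs_of_nonneg (norm_nonneg (_ : EuclideanSpace ℂ n)), ← sq_le_sq,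
    EuclideanSpace.norm_sq_eq]
  have hrow : ∀ i, ‖(A *ᵥ x.ofLp) i‖ ^ 2 ≤ Fintype.card n * (b ^ 2 * ‖x‖ ^ 2) := by
    intro i
    have h1 : ‖(A *ᵥ x.ofLp) i‖ ≤ ∑ j, b * ‖x j‖ := by
      refine (norm_sum_le _ _).trans (Finset.sum_le_sum fun j _ => ?_)
      rw [norm_mul]
      gcongr
      exact hA i j
    calc ‖(A *ᵥ x.ofLp) i‖ ^ 2 ≤ (∑ j, b * ‖x j‖) ^ 2 := by gcongr
      _ ≤ Fintype.card n * ∑ j, (b * ‖x j‖) ^ 2 := sq_sum_le_card_mul_sum_sq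
      _ = Fintype.card n * (b ^ 2 * ‖x‖ ^ 2) := by
        simp only [EuclideanSpace.norm_sq_eq, mul_pow, Finset.mul_sum]
  refine (Finset.sum_le_sum fun i _ => hrow i).trans (le_of_eq ?_)
  simp only [Finset.sum_const, Finset.card_univ, nsmul_eq_mul]
  ring

theorem norm_apply_le_l2_opNorm (A : Matrix n n ℂ) (i j : n) : ‖A i j‖ ≤ ‖A‖ := by
  have h := A.l2_opNorm_mulVec (EuclideanSpace.single j (1 : ℂ))
  rw [PiLp.norm_single, norm_one, mul_one] at h
  refine le_trans ?_ h
  refine le_trans (le_of_eq ?_) (PiLp.norm_apply_le _ i)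
  simp

end Matrix

/-! ### Entrywise expectation of random matrices. -/

section Expectation

variable {Ω : Type*} [MeasurableSpace Ω] {P : Measure Ω} {m n : Type*}

/-- All entries of the random matrix `A` are integrable. -/
def EntrywiseIntegrable (A : Ω → Matrix m n ℂ) (P : Measure Ω) : Prop :=
  ∀ i j, Integrable (fun x => A x i j) P

theorem EntrywiseIntegrable.add {A B : Ω → Matrix m n ℂ} (hA : EntrywiseIntegrable A P)
    (hB : EntrywiseIntegrable B P) : EntrywiseIntegrable (fun x => A x + B x) P :=
  fun i j => (hA i j).add (hB i j)

theorem EntrywiseIntegrable.sub {A B : Ω → Matrix m n ℂ} (hA : EntrywiseIntegrable A P)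
    (hB : EntrywiseIntegrable B P) : EntrywiseIntegrable (fun x => A x - B x) P :=
  fun i j => (hA i j).sub (hB i j)

theorem EntrywiseIntegrable.const_smul {A : Ω → Matrix m n ℂ} (hA : EntrywiseIntegrable A P)
    (c : ℝ) : EntrywiseIntegrable (fun x => c • A x) P :=
  fun i j => (hA i j).smul c

theorem EntrywiseIntegrable.const [IsFiniteMeasure P] (A : Matrix m n ℂ) :
    EntrywiseIntegrable (fun _ : Ω => A) P :=
  fun _ _ => integrable_const _

theorem matrixExpectation_add {A B : Ω → Matrix m n ℂ} (hA : EntrywiseIntegrable A P)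
    (hB : EntrywiseIntegrable B P) : matrixExpectation P (fun x => A x + B x) =
      matrixExpectation P A + matrixExpectation P B := by
  ext i j
  exact integral_add (hA i j) (hB i j)

theorem matrixExpectation_sub {A B : Ω → Matrix m n ℂ} (hA : EntrywiseIntegrable A P)
    (hB : EntrywiseIntegrable B P) : matrixExpectation P (fun x => A x - B x) =
      matrixExpectation P A - matrixExpectation P B := by
  ext i j
  exact integral_sub (hA i j) (hB i j)

theorem matrixExpectation_smul (c : ℝ) (A : Ω → Matrix m n ℂ) :
    matrixExpectation P (fun x => c • A x) = c • matrixExpectation P A := by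
  ext i j
  exact integral_smul c _

theorem matrixExpectation_const [IsProbabilityMeasure P] (A : Matrix m n ℂ) :
    matrixExpectation P (fun _ => A) = A := by
  ext i j
  simp [matrixExpectation]

theorem matrixExpectation_sum {ι : Type*} (s : Finset ι) {A : ι → Ω → Matrix m n ℂ}
    (hA : ∀ k ∈ s, EntrywiseIntegrable (A k) P) :
    matrixExpectation P (fun x => ∑ k ∈ s, A k x) = ∑ k ∈ s, matrixExpectation P (A k) := by
  ext i j
  simp only [matrixExpectation, Matrix.of_apply, Matrix.sum_apply]
  exact integral_finsetSum s fun k hk => hA k hk i j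

theorem matrixExpectation_conjTranspose (A : Ω → Matrix m n ℂ) :
    matrixExpectation P (fun x => (A x)ᴴ) = (matrixExpectation P A)ᴴ := by
  ext i j
  exact integral_conj

theorem matrixExpectation_isHermitian {A : Ω → Matrix n n ℂ} (hA : ∀ x, (A x).IsHermitian) :
    (matrixExpectation P A).IsHermitian := by
  rw [Matrix.IsHermitian, ← matrixExpectation_conjTranspose]
  congr 1
  funext x
  exact hA x

theorem HasLaw.matrixExpectation_comp {μ : Measure ℝ} {X : Ω → ℝ} (hX : HasLaw X μ P)
    {A : ℝ → Matrix m n ℂ} (hA : ∀ i j, Measurable fun s => A s i j) :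
    matrixExpectation P (fun x => A (X x)) = matrixExpectation μ A := by
  ext i j
  exact hX.integral_comp (f := fun s => A s i j) (hA i j).aestronglyMeasurable

variable [Fintype n]

/-- The quadratic form of the expectation is the expectation of the quadratic form. -/
theorem matrixExpectation_posSemidef {A : Ω → Matrix n n ℂ} (hint : EntrywiseIntegrable A P)
    (hherm : ∀ x, (A x).IsHermitian) (hA : ∀ᵐ x ∂P, (A x).PosSemidef) :
    (matrixExpectation P A).PosSemidef := by
  refine Matrix.PosSemidef.of_dotProduct_mulVec_nonneg (matrixExpectation_isHermitian hherm)
    fun v => ?_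
  have h : star v ⬝ᵥ matrixExpectation P A *ᵥ v = ∫ x, star v ⬝ᵥ A x *ᵥ v ∂P := by
    simp only [dotProduct, Matrix.mulVec, matrixExpectation, Matrix.of_apply]
    rw [integral_finsetSum _ fun i _ => (integrable_finsetSum _ fun j _ =>
      (hint i j).mul_const _).const_mul _]
    refine Finset.sum_congr rfl fun i _ => ?_
    rw [integral_const_mul, integral_finsetSum _ fun j _ => (hint i j).mul_const _]
    congr 1
    exact Finset.sum_congr rfl fun j _ => (integral_mul_const _ _).symm
  rw [h]
  refine integral_nonneg_of_ae ?_
  filter_upwards [hA] with x hx using hx.dotProduct_mulVec_nonneg v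

theorem trace_matrixExpectation {A : Ω → Matrix n n ℂ} (hint : EntrywiseIntegrable A P) :
    (matrixExpectation P A).trace = ∫ x, (A x).trace ∂P := by
  simp only [Matrix.trace, matrixExpectation, Matrix.diag_apply, Matrix.of_apply]
  rw [integral_finsetSum _ fun i _ => hint i i]

theorem EntrywiseIntegrable.trace {A : Ω → Matrix n n ℂ} (hint : EntrywiseIntegrable A P) :
    Integrable (fun x => (A x).trace) P :=
  integrable_finsetSum _ fun i _ => hint i i

theorem re_integral_trace {A : Ω → Matrix n n ℂ} (hint : EntrywiseIntegrable A P) :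
    ∫ x, (A x).trace.re ∂P = (matrixExpectation P A).trace.re := by
  rw [trace_matrixExpectation hint]
  exact integral_re hint.trace

theorem matrixExpectation_mul {A B : Ω → Matrix n n ℂ} (hA : EntrywiseIntegrable A P)
    (hB : EntrywiseIntegrable B P)
    (hAB : ∀ i j k l, IndepFun (fun x => A x i j) (fun x => B x k l) P) :
    EntrywiseIntegrable (fun x => A x * B x) P ∧
    matrixExpectation P (fun x => A x * B x) = matrixExpectation P A * matrixExpectation P B := by
  have hint : ∀ i j k, Integrable (fun x => A x i j * B x j k) P := fun i j k =>
    (hAB i j j k).integrable_mul (hA i j) (hB j k)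
  constructor
  · intro i k
    simp only [Matrix.mul_apply]
    exact integrable_finsetSum _ fun j _ => hint i j k
  · ext i k
    simp only [Matrix.mul_apply, matrixExpectation, Matrix.of_apply]
    rw [integral_finsetSum _ fun j _ => hint i j k]
    exact Finset.sum_congr rfl fun j _ => (hAB i j j k).integral_fun_mul_eq_mul_integral
      (hA i j).aestronglyMeasurable (hB j k).aestronglyMeasurable

theorem EntrywiseIntegrable.of_norm_le [DecidableEq n] [IsFiniteMeasure P] {A : Ω → Matrix n n ℂ}
    (hA : ∀ i j, AEMeasurable (fun x => A x i j) P) {b : ℝ} (hb : ∀ x, ‖A x‖ ≤ b) :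
    EntrywiseIntegrable A P := fun i j =>
  Integrable.of_bound (hA i j).aestronglyMeasurable b
    (.of_forall fun x => ((A x).norm_apply_le_l2_opNorm i j).trans (hb x))

end Expectation

/-! ### Trace exponential moments of independent sums. -/

section ExponentialMoment

theorem Matrix.isHermitian_sum {n ι : Type*} (s : Finset ι) {A : ι → Matrix n n ℂ}
    (hA : ∀ i ∈ s, (A i).IsHermitian) : (∑ i ∈ s, A i).IsHermitian := by
  rw [Matrix.IsHermitian, Matrix.conjTranspose_sum]
  exact Finset.sum_congr rfl fun i hi => (hA i hi).eq

variable {Ω : Type*} [MeasurableSpace Ω] {P : Measure Ω} {n : Type*} [Fintype n] [DecidableEq n]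

theorem Matrix.continuous_exp : Continuous (NormedSpace.exp : Matrix n n ℂ → Matrix n n ℂ) := by
  let _ : NormedAlgebra ℚ (Matrix n n ℂ) := NormedAlgebra.restrictScalars ℚ ℂ _
  exact NormedSpace.exp_continuous

variable {ι : Type*} {τ : ι → Ω → ℝ} {F : ℝ → Matrix n n ℂ} {b : ℝ}

theorem indepFun_exp_sum_exp (hindep : iIndepFun τ P) (hτ : ∀ k, AEMeasurable (τ k) P)
    (hF : Continuous F) {s : Finset ι} {k : ι} (hk : k ∉ s) (i j i' j' : n) :
    IndepFun (fun x => NormedSpace.exp (∑ k ∈ s, F (τ k x)) i j)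
      (fun x => NormedSpace.exp (F (τ k x)) i' j') P := by
  have h := hindep.indepFun_finset₀ s {k} (Finset.disjoint_singleton_right.mpr hk) hτ
  have hφ : Continuous fun u : s → ℝ => NormedSpace.exp (∑ k, F (u k)) i j :=
    (Matrix.continuous_exp.comp (continuous_finsetSum _ fun k _ =>
      hF.comp (continuous_apply k))).matrix_elem i j
  have hψ : Continuous fun u : ({k} : Finset ι) → ℝ =>
      NormedSpace.exp (F (u ⟨k, Finset.mem_singleton_self k⟩)) i' j' :=
    (Matrix.continuous_exp.comp (hF.comp (continuous_apply _))).matrix_elem i' j'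
  have := h.comp hφ.measurable hψ.measurable
  convert this using 1
  · funext x
    simp only [Function.comp]
    rw [← Finset.sum_coe_sort s fun k => F (τ k x)]
  · rfl

variable [Nonempty n] [IsProbabilityMeasure P]

theorem entrywiseIntegrable_exp_sum (hτ : ∀ k, AEMeasurable (τ k) P) (hF : Continuous F)
    (hb : ∀ s, ‖F s‖ ≤ b) (s : Finset ι) :
    EntrywiseIntegrable (fun x => NormedSpace.exp (∑ k ∈ s, F (τ k x))) P := by
  refine EntrywiseIntegrable.of_norm_le (fun i j => ?_) (b := Real.exp (s.card * b)) fun x => ?_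
  · have hcont : Continuous fun u : s → ℝ => NormedSpace.exp (∑ k, F (u k)) i j :=
      (Matrix.continuous_exp.comp (continuous_finsetSum _ fun k _ =>
        hF.comp (continuous_apply k))).matrix_elem i j
    have := hcont.measurable.comp_aemeasurable
      (aemeasurable_pi_lambda (fun x (k : s) => τ k x) fun k => hτ k)
    refine this.congr (.of_forall fun x => ?_)
    simp only [Function.comp]
    rw [← Finset.sum_coe_sort s fun k => F (τ k x)]
  · refine (norm_normedSpaceExp_le _).trans (Real.exp_le_exp.mpr ?_)
    refine (norm_sum_le_of_le s fun k _ => hb (τ k x)).trans (le_of_eq ?_)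
    simp

/-- Golden–Thompson detaches one factor, independence separates its expectation, and positivity of
the trace of a product of positive semidefinite matrices lets `L` replace it. The empty sum
contributes the dimension. -/
theorem integral_re_trace_exp_sum_le (hindep : iIndepFun τ P) (hτ : ∀ k, AEMeasurable (τ k) P)
    (hF : Continuous F) (hherm : ∀ s, (F s).IsHermitian) (hb : ∀ s, ‖F s‖ ≤ b) {L : ℝ}
    (hL0 : 0 ≤ L) (hL : ∀ k, (L • (1 : Matrix n n ℂ) -
      matrixExpectation P fun x => NormedSpace.exp (F (τ k x))).PosSemidef) (s : Finset ι) :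
    ∫ x, (NormedSpace.exp (∑ k ∈ s, F (τ k x))).trace.re ∂P ≤ Fintype.card n * L ^ s.card := by
  classical
  induction s using Finset.induction_on with
  | empty => simp [Matrix.trace]
  | insert k s hk ih =>
    have hS := entrywiseIntegrable_exp_sum (P := P) hτ hF hb s
    have hk1 : EntrywiseIntegrable (fun x => NormedSpace.exp (F (τ k x))) P := by
      simpa using entrywiseIntegrable_exp_sum (P := P) hτ hF hb {k}
    have hSherm : ∀ x, (∑ k ∈ s, F (τ k x)).IsHermitian := fun x =>
      Matrix.isHermitian_sum s fun _ _ => hherm _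
    obtain ⟨hint, hmul⟩ := matrixExpectation_mul hS hk1
      fun i j i' j' => indepFun_exp_sum_exp hindep hτ hF hk i j i' j'
    have hpsd : (matrixExpectation P fun x =>
        NormedSpace.exp (∑ k ∈ s, F (τ k x))).PosSemidef :=
      matrixExpectation_posSemidef hS (fun x => (hSherm x).exp_posSemidef.isHermitian)
        (.of_forall fun x => (hSherm x).exp_posSemidef)
    have hle := (Complex.le_def.mp (hpsd.trace_mul_nonneg (hL k))).1
    rw [mul_sub, Matrix.trace_sub, mul_smul_comm, mul_one, Matrix.trace_smul, Complex.sub_re,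
      Complex.smul_re, Complex.zero_re, smul_eq_mul, ← re_integral_trace hS] at hle
    calc ∫ x, (NormedSpace.exp (∑ k ∈ insert k s, F (τ k x))).trace.re ∂P
        ≤ ∫ x, (NormedSpace.exp (∑ k ∈ s, F (τ k x)) *
            NormedSpace.exp (F (τ k x))).trace.re ∂P := by
          refine integral_mono
            (entrywiseIntegrable_exp_sum (P := P) hτ hF hb (insert k s)).trace.re hint.trace.re
            fun x => ?_
          simp only [Finset.sum_insert hk]
          rw [add_comm]
          exact (hSherm x).re_trace_exp_add_le (hherm _)
      _ = ((matrixExpectation P fun x => NormedSpace.exp (∑ k ∈ s, F (τ k x))) *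
            matrixExpectation P fun x => NormedSpace.exp (F (τ k x))).trace.re := by
          rw [re_integral_trace hint, hmul]
      _ ≤ L * ∫ x, (NormedSpace.exp (∑ k ∈ s, F (τ k x))).trace.re ∂P := by linarith
      _ ≤ L * (Fintype.card n * L ^ s.card) := by gcongr
      _ = Fintype.card n * L ^ (insert k s).card := by
          rw [Finset.card_insert_of_notMem hk]; ring

/-- The exponential moment of a centred random Hermitian matrix that is almost surely bounded. -/
theorem posSemidef_smul_one_sub_matrixExpectation_exp {Y : Ω → Matrix n n ℂ}
    (hherm : ∀ x, (Y x).IsHermitian) (hY : EntrywiseIntegrable Y P)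
    (hY2 : EntrywiseIntegrable (fun x => Y x ^ 2) P)
    (hYe : EntrywiseIntegrable (fun x => NormedSpace.exp (Y x)) P)
    (hmean : matrixExpectation P Y = 0) {c : ℝ} (hc : c < 3) (hbound : ∀ᵐ x ∂P, ‖Y x‖ ≤ c) :
    (Real.exp ((2 * (1 - c / 3))⁻¹ * ‖matrixExpectation P fun x => Y x ^ 2‖) •
      (1 : Matrix n n ℂ) - matrixExpectation P fun x => NormedSpace.exp (Y x)).PosSemidef := by
  set κ := (2 * (1 - c / 3))⁻¹ with hκ
  set V := matrixExpectation P fun x => Y x ^ 2 with hV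
  have hκ0 : 0 ≤ κ := inv_nonneg.mpr (by linarith)
  have h1 : (matrixExpectation P fun x => 1 + Y x + κ • Y x ^ 2 -
      NormedSpace.exp (Y x)).PosSemidef := by
    refine matrixExpectation_posSemidef ((((EntrywiseIntegrable.const 1).add hY).add
      (hY2.const_smul κ)).sub hYe) (fun x => ?_) ?_
    · exact ((Matrix.isHermitian_one.add (hherm x)).add
        ((IsSelfAdjoint.all κ).smul ((hherm x).pow 2).isSelfAdjoint).isHermitian).sub
        (hherm x).exp
    · filter_upwards [hbound] with x hx
      exact (hherm x).posSemidef_one_add_add_sub_exp hx hc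
  rw [matrixExpectation_sub (((EntrywiseIntegrable.const 1).add hY).add (hY2.const_smul κ)) hYe,
    matrixExpectation_add ((EntrywiseIntegrable.const 1).add hY) (hY2.const_smul κ),
    matrixExpectation_add (EntrywiseIntegrable.const 1) hY, matrixExpectation_const, hmean,
    matrixExpectation_smul, ← hV, add_zero] at h1
  have hVherm : V.IsHermitian := matrixExpectation_isHermitian fun x => (hherm x).pow 2
  -- The claim is a sum of three positive terms: $1+\kappa V-\mathbb Ee^Y$, $\kappa(\|V\|-V)$ and
  -- $e^{\kappa\|V\|}-\kappa\|V\|-1$.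
  have h2 := hVherm.posSemidef_norm_smul_one_sub.smul hκ0
  have h3 : ((Real.exp (κ * ‖V‖) - (κ * ‖V‖ + 1)) • (1 : Matrix n n ℂ)).PosSemidef :=
    Matrix.PosSemidef.one.smul (sub_nonneg.mpr (Real.add_one_le_exp _))
  have := (h1.add h2).add h3
  convert this using 1
  module

end ExponentialMoment

/-! ### Matrix Bernstein, lower tail. -/

section Bernstein

variable {Ω : Type*} [MeasurableSpace Ω] {P : Measure Ω} [IsProbabilityMeasure P]
  {n : Type*} [Fintype n] [DecidableEq n] [Nonempty n] {N : ℕ} {τ : Fin N → Ω → ℝ}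
  {μ : Measure ℝ} {X : ℝ → Matrix n n ℂ} {b R v t : ℝ}

/-- The lower tail of the **matrix Bernstein inequality** for identically distributed summands. -/
theorem matrix_bernstein_lower_tail_of_pos (hlaw : ∀ k, HasLaw (τ k) μ P)
    (hindep : iIndepFun τ P) (hX : Continuous X) (hherm : ∀ s, (X s).IsHermitian)
    (hb : ∀ s, ‖X s‖ ≤ b) (hmean : matrixExpectation μ X = 0)
    (hR : ∀ k, ∀ᵐ x ∂P, ‖X (τ k x)‖ ≤ R) (hR0 : 0 ≤ R)
    (hv : N * ‖matrixExpectation μ fun s => X s ^ 2‖ ≤ v) (hv0 : 0 < v) (ht : 0 < t) :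
    P.real {x | ¬ (t • (1 : Matrix n n ℂ) + ∑ k, X (τ k x)).PosSemidef} ≤
      Fintype.card n * Real.exp (-((t ^ 2 / 2) / (v + R * t / 3))) := by
  set V := ‖matrixExpectation μ fun s => X s ^ 2‖ with hV
  set D := v + R * t / 3 with hD
  have hD0 : 0 < D := by positivity
  -- This Laplace parameter makes $1-\theta R/3=v/D$, so the moment exponent is $t^2/(2D)=\theta
  -- t-t^2/(2D)$. The strict bound `0 < v` gives `c < 3`.
  set θ := t / D with hθ
  have hθ0 : 0 < θ := by positivity
  set c := θ * R with hc
  have h1c : 1 - c / 3 = v / D := by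
    rw [hc, hθ, eq_div_iff hD0.ne', sub_mul, one_mul]
    field_simp
    rw [hD]
    ring
  have hc3 : c < 3 := by
    have : 0 < 1 - c / 3 := h1c ▸ div_pos hv0 hD0
    linarith
  set F : ℝ → Matrix n n ℂ := fun s => (-θ) • X s with hFdef
  have hτ : ∀ k, AEMeasurable (τ k) P := fun k => (hlaw k).aemeasurable
  have hF : Continuous F := hX.const_smul (-θ)
  have hFherm : ∀ s, (F s).IsHermitian := fun s =>
    ((IsSelfAdjoint.all (-θ)).smul (hherm s).isSelfAdjoint).isHermitian
  have hFnorm : ∀ s, ‖F s‖ = θ * ‖X s‖ := fun s => by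
    rw [hFdef, norm_smul, norm_neg, Real.norm_of_nonneg hθ0.le]
  -- The sure bound `b` serves integrability only; the almost sure bound `R` is what enters the
  -- exponent.
  have hFb : ∀ s, ‖F s‖ ≤ θ * b := fun s => by
    rw [hFnorm]
    gcongr
    exact hb s
  have hX2 : ∀ k, matrixExpectation P (fun x => X (τ k x) ^ 2) =
      matrixExpectation μ fun s => X s ^ 2 := fun k =>
    HasLaw.matrixExpectation_comp (hlaw k) (A := fun s => X s ^ 2)
      fun i j => ((hX.pow 2).matrix_elem i j).measurable
  set L := Real.exp ((2 * (1 - c / 3))⁻¹ * (θ ^ 2 * V)) with hL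
  have hLk : ∀ k, (L • (1 : Matrix n n ℂ) -
      matrixExpectation P fun x => NormedSpace.exp (F (τ k x))).PosSemidef := by
    intro k
    have hint : ∀ {A : ℝ → Matrix n n ℂ} {B : ℝ}, Continuous A → (∀ s, ‖A s‖ ≤ B) →
        EntrywiseIntegrable (fun x => A (τ k x)) P := fun hA hB =>
      .of_norm_le (fun i j => (hA.matrix_elem i j).measurable.comp_aemeasurable (hτ k))
        fun x => hB _
    have hF2 : matrixExpectation P (fun x => F (τ k x) ^ 2) =
        θ ^ 2 • matrixExpectation μ fun s => X s ^ 2 := by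
      rw [← hX2 k, ← matrixExpectation_smul]
      congr 1
      funext x
      rw [hFdef, smul_pow, neg_sq]
    have := posSemidef_smul_one_sub_matrixExpectation_exp (P := P) (Y := fun x => F (τ k x))
      (fun x => hFherm _) (hint hF hFb)
      (hint (A := fun s => F s ^ 2) (B := (θ * b) ^ 2) (hF.pow 2) fun s =>
        (norm_pow_le _ 2).trans (pow_le_pow_left₀ (norm_nonneg _) (hFb s) 2))
      (hint (A := fun s => NormedSpace.exp (F s)) (B := Real.exp (θ * b))
        (Matrix.continuous_exp.comp hF) fun s =>
          (norm_normedSpaceExp_le _).trans (Real.exp_le_exp.mpr (hFb s)))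
      (by
        rw [HasLaw.matrixExpectation_comp (hlaw k) (A := F)
          fun i j => (hF.matrix_elem i j).measurable, matrixExpectation_smul, hmean, smul_zero])
      hc3 (by
        filter_upwards [hR k] with x hx
        rw [hFnorm]
        exact mul_le_mul_of_nonneg_left hx hθ0.le)
    rwa [hF2, norm_smul, Real.norm_of_nonneg (by positivity), ← hV, ← hL] at this
  have hmgf := integral_re_trace_exp_sum_le hindep hτ hF hFherm hFb (Real.exp_pos _).le hLk
    Finset.univ
  set g : Ω → ℝ := fun x => (NormedSpace.exp (∑ k, F (τ k x))).trace.re with hg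
  have hSherm : ∀ x, (∑ k, F (τ k x)).IsHermitian := fun x =>
    Matrix.isHermitian_sum _ fun _ _ => hFherm _
  have hg0 : 0 ≤ᵐ[P] g := .of_forall fun x =>
    (Complex.le_def.mp (hSherm x).exp_posSemidef.trace_nonneg).1
  have hgint : Integrable g P := (entrywiseIntegrable_exp_sum hτ hF hFb Finset.univ).trace.re
  have hmarkov := mul_meas_ge_le_integral_of_nonneg hg0 hgint (Real.exp (θ * t))
  have hsub : {x | ¬ (t • (1 : Matrix n n ℂ) + ∑ k, X (τ k x)).PosSemidef} ⊆
      {x | Real.exp (θ * t) ≤ g x} := by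
    intro x hx
    by_contra hlt
    apply hx
    have := ((hSherm x).posSemidef_smul_one_sub_of_trace_exp_le
      (not_le.mp hlt).le).smul (inv_nonneg.mpr hθ0.le)
    convert this using 1
    rw [hFdef, ← Finset.smul_sum, smul_sub, smul_smul, smul_smul, mul_neg, ← mul_assoc,
      inv_mul_cancel₀ hθ0.ne', one_mul, neg_smul, one_smul, sub_neg_eq_add]
  have hexp : L ^ N ≤ Real.exp (θ * t - (t ^ 2 / 2) / D) := by
    rw [hL, ← Real.exp_nat_mul]
    refine Real.exp_le_exp.mpr ?_
    calc (N : ℝ) * ((2 * (1 - c / 3))⁻¹ * (θ ^ 2 * V))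
        = (2 * (1 - c / 3))⁻¹ * θ ^ 2 * (N * V) := by ring
      _ ≤ (2 * (1 - c / 3))⁻¹ * θ ^ 2 * v := by
        have : 0 < 1 - c / 3 := h1c ▸ div_pos hv0 hD0
        gcongr
      _ = θ * t - (t ^ 2 / 2) / D := by
        rw [h1c, hθ]
        field_simp
        ring
  rw [Finset.card_univ, Fintype.card_fin] at hmgf
  refine (measureReal_mono hsub).trans ?_
  rw [← mul_le_mul_iff_right₀ (Real.exp_pos (θ * t))]
  refine (hmarkov.trans hmgf).trans ((mul_le_mul_of_nonneg_left hexp (by positivity)).trans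
    (le_of_eq ?_))
  rw [sub_eq_add_neg, Real.exp_add]
  ring

/-- The lower tail of the **matrix Bernstein inequality** for identically distributed summands,
including the degenerate case of vanishing variance. -/
theorem matrix_bernstein_lower_tail (hlaw : ∀ k, HasLaw (τ k) μ P)
    (hindep : iIndepFun τ P) (hX : Continuous X) (hherm : ∀ s, (X s).IsHermitian)
    (hb : ∀ s, ‖X s‖ ≤ b) (hmean : matrixExpectation μ X = 0)
    (hR : ∀ k, ∀ᵐ x ∂P, ‖X (τ k x)‖ ≤ R) (hR0 : 0 ≤ R)
    (hv : N * ‖matrixExpectation μ fun s => X s ^ 2‖ ≤ v) (ht : 0 < t) :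
    P.real {x | ¬ (t • (1 : Matrix n n ℂ) + ∑ k, X (τ k x)).PosSemidef} ≤
      Fintype.card n * Real.exp (-((t ^ 2 / 2) / (v + R * t / 3))) := by
  -- For `R = 0` the summands vanish almost surely and the bad event is null; this absorbs `v = R =
  -- 0`, where the fraction is 0 by the convention `x / 0 = 0`. For `R > 0` the denominator stays
  -- positive even at `v = 0`, and the bound is the limit of the strict case as `w ↓ v`.
  rcases hR0.eq_or_lt with rfl | hRpos
  · have h0 : P {x | ¬ (t • (1 : Matrix n n ℂ) + ∑ k, X (τ k x)).PosSemidef} = 0 := by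
      change ∀ᵐ x ∂P, _
      filter_upwards [ae_all_iff.mpr hR] with x hx
      rw [Finset.sum_eq_zero fun k _ => norm_le_zero_iff.mp (hx k), add_zero]
      exact Matrix.PosSemidef.one.smul ht.le
    rw [measureReal_def, h0, ENNReal.toReal_zero]
    positivity
  · have hv0 : 0 ≤ v := le_trans (by positivity) hv
    have hcont : ContinuousAt (fun w => Fintype.card n *
        Real.exp (-((t ^ 2 / 2) / (w + R * t / 3)))) v := by
      have : v + R * t / 3 ≠ 0 := by positivity
      fun_prop (disch := assumption)
    refine ge_of_tendsto (hcont.tendsto.mono_left nhdsWithin_le_nhds :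
      Filter.Tendsto _ (nhdsWithin v (Set.Ioi v)) _) ?_
    filter_upwards [self_mem_nhdsWithin] with w hw
    exact matrix_bernstein_lower_tail_of_pos hlaw hindep hX hherm hb hmean hR hR0
      (hv.trans (le_of_lt hw)) (hv0.trans_lt hw) ht

end Bernstein

/-! ### The sampling matrices and their bounds. -/

section Sampling

variable {M N : ℕ} (ω : Fin M → ℝ)

/-- The rank-one matrix contributed by a sample taken at time `s`. -/
noncomputable def sampleTerm (s : ℝ) : Matrix (Fin (2 * M + 1)) (Fin (2 * M + 1)) ℂ :=
  rankOneTerm ω (fun _ : Fin 1 => s) 0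

theorem rankOneTerm_eq_sampleTerm (s : Fin N → ℝ) (k : Fin N) :
    rankOneTerm ω s k = sampleTerm ω (s k) := rfl

theorem gramR_eq_sum_sampleTerm (s : Fin N → ℝ) : gramR ω s = ∑ k, sampleTerm ω (s k) := by
  ext i j
  simp only [gramR, Matrix.mul_apply, Matrix.sum_apply]
  rfl

theorem continuous_sampleTerm : Continuous (sampleTerm ω) := by
  refine continuous_matrix fun i j => ?_
  simp only [sampleTerm, rankOneTerm, Matrix.vecMulVec_apply, vandermondePsi, Matrix.of_apply,
    Pi.star_apply]
  fun_prop

theorem sampleTerm_isHermitian (s : ℝ) : (sampleTerm ω s).IsHermitian := by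
  have := (Matrix.posSemidef_vecMulVec_star_self
    (vandermondePsi ω (fun _ : Fin 1 => s) 0)).isHermitian
  exact this

theorem norm_sampleTerm_apply (s : ℝ) (i j : Fin (2 * M + 1)) : ‖sampleTerm ω s i j‖ = 1 := by
  have h : ∀ l, ‖vandermondePsi ω (fun _ : Fin 1 => s) 0 l‖ = 1 := fun l => by
    rw [vandermondePsi, Matrix.of_apply, mul_comm, Complex.norm_exp_ofReal_mul_I]
  rw [sampleTerm, rankOneTerm, Matrix.vecMulVec_apply, norm_mul, Pi.star_apply, norm_star, h, h,
    one_mul]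

variable {μ : Measure ℝ}

/-- The centred contribution of a sample taken at time `s`. -/
noncomputable def centredSampleTerm (μ : Measure ℝ) (s : ℝ) : Matrix (Fin (2 * M + 1)) (Fin (2 * M + 1)) ℂ :=
  sampleTerm ω s - matrixExpectation μ (sampleTerm ω)

theorem continuous_centredSampleTerm : Continuous (centredSampleTerm ω μ) :=
  (continuous_sampleTerm ω).sub continuous_const

theorem centredSampleTerm_isHermitian (s : ℝ) : (centredSampleTerm ω μ s).IsHermitian :=
  (sampleTerm_isHermitian ω s).sub (matrixExpectation_isHermitian (sampleTerm_isHermitian ω))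

variable [IsProbabilityMeasure μ]

theorem entrywiseIntegrable_sampleTerm : EntrywiseIntegrable (sampleTerm ω) μ := fun i j =>
  .of_bound ((continuous_sampleTerm ω).matrix_elem i j).aestronglyMeasurable 1
    (.of_forall fun s => (norm_sampleTerm_apply ω s i j).le)

theorem matrixExpectation_centredSampleTerm :
    matrixExpectation μ (centredSampleTerm ω μ) = 0 := by
  have := matrixExpectation_sub (entrywiseIntegrable_sampleTerm ω (μ := μ))
    (EntrywiseIntegrable.const (matrixExpectation μ (sampleTerm ω)))
  rw [matrixExpectation_const, sub_self] at this
  exact this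

theorem norm_centredSampleTerm_apply_le (s : ℝ) (i j : Fin (2 * M + 1)) :
    ‖centredSampleTerm ω μ s i j‖ ≤ 2 := by
  have h : ‖matrixExpectation μ (sampleTerm ω) i j‖ ≤ 1 := by
    have := norm_integral_le_of_norm_le_const (μ := μ) (f := fun s => sampleTerm ω s i j) (C := 1)
      (.of_forall fun s => (norm_sampleTerm_apply ω s i j).le)
    rw [probReal_univ, mul_one] at this
    exact this
  refine (norm_sub_le _ _).trans ?_
  rw [norm_sampleTerm_apply]
  linarith

theorem norm_centredSampleTerm_le (s : ℝ) :
    ‖centredSampleTerm ω μ s‖ ≤ 2 * (2 * (M : ℝ) + 1) := by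
  have := Matrix.l2_opNorm_le_card_mul zero_le_two (norm_centredSampleTerm_apply_le ω (μ := μ) s)
  rw [Fintype.card_fin] at this
  push_cast at this
  linarith

/-- Each entry of the square is a sum of $2M+1$ products of size at most 4; passing from entries to
the norm costs the second factor $2M+1$. -/
theorem norm_matrixExpectation_centredSampleTerm_sq_le :
    ‖matrixExpectation μ fun s => centredSampleTerm ω μ s ^ 2‖ ≤ 4 * (2 * (M : ℝ) + 1) ^ 2 := by
  have hentry : ∀ s (i j : Fin (2 * M + 1)),
      ‖(centredSampleTerm ω μ s ^ 2) i j‖ ≤ 4 * (2 * (M : ℝ) + 1) := by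
    intro s i j
    rw [sq, Matrix.mul_apply]
    refine (norm_sum_le_of_le (Finset.univ : Finset (Fin (2 * M + 1))) (n := fun _ => (4 : ℝ))
      fun l _ => ?_).trans (le_of_eq ?_)
    · rw [norm_mul]
      calc _ ≤ (2 : ℝ) * 2 := mul_le_mul (norm_centredSampleTerm_apply_le ω s i l)
            (norm_centredSampleTerm_apply_le ω s l j) (norm_nonneg _) zero_le_two
        _ = 4 := by norm_num
    · simp only [Finset.sum_const, Finset.card_univ, Fintype.card_fin, nsmul_eq_mul]
      push_cast
      ring
  have := Matrix.l2_opNorm_le_card_mul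
    (A := matrixExpectation μ fun s => centredSampleTerm ω μ s ^ 2)
    (b := 4 * (2 * (M : ℝ) + 1)) (by positivity) fun i j => by
      have := norm_integral_le_of_norm_le_const (μ := μ)
        (f := fun s => (centredSampleTerm ω μ s ^ 2) i j)
        (.of_forall fun s => hentry s i j)
      rw [probReal_univ, mul_one] at this
      exact this
  rw [Fintype.card_fin] at this
  push_cast at this
  linarith

end Sampling

/-! ### The main theorem. -/

theorem IsSamplingDensity.isProbabilityMeasure {T : ℝ} {p : ℝ → ℝ} (hp : IsSamplingDensity T p) :
    IsProbabilityMeasure (densityLaw p) :=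
  ⟨by rw [densityLaw, withDensity_apply _ MeasurableSet.univ, Measure.restrict_univ,
    hp.lintegral_eq_one]⟩

theorem lemma3 {Ω : Type*} [MeasurableSpace Ω] (P : Measure Ω) [IsProbabilityMeasure P]
    (M N : ℕ) (ω : Fin M → ℝ) (T : ℝ) (p : ℝ → ℝ) (hp : IsSamplingDensity T p)
    (τ : Fin N → Ω → ℝ) (hlaw : ∀ k, HasLaw (τ k) (densityLaw p) P) (hindep : iIndepFun τ P) :
    -- the constants `R = 2(2M+1)` and `v = 4N(2M+1)²` are admissible below
    (∀ k, ∀ᵐ x ∂P, ‖centredTerm P ω τ k x‖ ≤ 2 * (2 * (M : ℝ) + 1)) ∧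
    matrixVariance P ω τ ≤ 4 * (N : ℝ) * (2 * (M : ℝ) + 1) ^ 2 ∧
    -- the high-probability bound, for every admissible pair `R`, `v`
    ∀ R v t δ : ℝ,
      (∀ k, ∀ᵐ x ∂P, ‖centredTerm P ω τ k x‖ ≤ R) →
      matrixVariance P ω τ ≤ v →
      0 < t → t < lambdaMin (expectedGram P ω τ) →
      (2 * (M : ℝ) + 1) * Real.exp (-((t ^ 2 / 2) / (v + R * t / 3))) = δ →
      1 - δ ≤ P.real {x |
        (gramR ω fun k => τ k x).PosDef ∧
        ((lambdaMin (expectedGram P ω τ) - t)⁻¹ •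
            (1 : Matrix (Fin (2 * M + 1)) (Fin (2 * M + 1)) ℂ) -
          (gramR ω fun k => τ k x)⁻¹).PosSemidef} := by
  have := hp.isProbabilityMeasure
  set μ := densityLaw p
  have hcentred : ∀ k x, centredTerm P ω τ k x = centredSampleTerm ω μ (τ k x) := by
    intro k x
    rw [centredTerm, centredSampleTerm, rankOneTerm_eq_sampleTerm]
    simp only [rankOneTerm_eq_sampleTerm]
    rw [HasLaw.matrixExpectation_comp (hlaw k)
      fun i j => ((continuous_sampleTerm ω).matrix_elem i j).measurable]
  -- Equal laws make the variance `N` copies of one matrix, so the norm of the sum is the sum of the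
  -- norms.
  have hvar : matrixVariance P ω τ =
      N * ‖matrixExpectation μ fun s => centredSampleTerm ω μ s ^ 2‖ := by
    have h : ∀ k, (matrixExpectation P fun x => centredTerm P ω τ k x ^ 2) =
        matrixExpectation μ fun s => centredSampleTerm ω μ s ^ 2 := by
      intro k
      simp only [hcentred]
      exact HasLaw.matrixExpectation_comp (hlaw k) (A := fun s => centredSampleTerm ω μ s ^ 2)
        fun i j => (((continuous_centredSampleTerm ω).pow 2).matrix_elem i j).measurable
    rw [matrixVariance, Finset.sum_congr rfl fun k _ => h k, Finset.sum_const, Finset.card_univ,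
      Fintype.card_fin, ← Nat.cast_smul_eq_nsmul ℝ, norm_smul, Real.norm_natCast]
  have hgram : ∀ x, gramR ω (fun k => τ k x) =
      expectedGram P ω τ + ∑ k, centredSampleTerm ω μ (τ k x) := by
    intro x
    have h : expectedGram P ω τ = ∑ _k : Fin N, matrixExpectation μ (sampleTerm ω) := by
      simp only [expectedGram, gramR_eq_sum_sampleTerm]
      rw [matrixExpectation_sum Finset.univ (A := fun k x => sampleTerm ω (τ k x)) fun k _ i j =>
        Integrable.of_bound (((continuous_sampleTerm ω).matrix_elem i j).measurable.comp_aemeasurable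
          (hlaw k).aemeasurable).aestronglyMeasurable 1
          (.of_forall fun x => (norm_sampleTerm_apply ω (τ k x) i j).le)]
      exact Finset.sum_congr rfl fun k _ => HasLaw.matrixExpectation_comp (hlaw k)
        fun i j => ((continuous_sampleTerm ω).matrix_elem i j).measurable
    rw [h, gramR_eq_sum_sampleTerm, ← Finset.sum_add_distrib]
    exact Finset.sum_congr rfl fun k _ => (add_sub_cancel _ _).symm
  refine ⟨fun k => .of_forall fun x => ?_, ?_, ?_⟩
  · rw [hcentred]
    exact norm_centredSampleTerm_le ω _
  · rw [hvar]
    have := mul_le_mul_of_nonneg_left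
      (norm_matrixExpectation_centredSampleTerm_sq_le ω (μ := μ)) (Nat.cast_nonneg (α := ℝ) N)
    linarith
  intro R v t δ hR hv ht htl hδ
  -- For `N = 0` the expected Gram matrix is 0 and no `t` is admissible. A sample must exist for the
  -- almost sure bound to force `0 ≤ R`.
  have hN : 0 < N := by
    rcases Nat.eq_zero_or_pos N with rfl | hN
    · have h0 : expectedGram P ω τ = 0 := by
        ext i j
        simp [expectedGram, matrixExpectation, gramR, Matrix.mul_apply]
      rw [h0, lambdaMin, spectrum.zero_eq, csInf_singleton] at htl
      exact absurd ht htl.not_gt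
    · exact hN
  have hR0 : 0 ≤ R := by
    obtain ⟨x, hx⟩ := (hR ⟨0, hN⟩).exists
    exact (norm_nonneg _).trans hx
  have htail := matrix_bernstein_lower_tail hlaw hindep (continuous_centredSampleTerm ω)
    (centredSampleTerm_isHermitian ω) (norm_centredSampleTerm_le ω)
    (matrixExpectation_centredSampleTerm ω)
    (fun k => by simpa only [hcentred] using hR k) hR0 (hvar ▸ hv) ht
  rw [Fintype.card_fin] at htail
  push_cast at htail
  rw [hδ] at htail
  have hherm : (expectedGram P ω τ).IsHermitian :=
    matrixExpectation_isHermitian fun x => Matrix.isHermitian_conjTranspose_mul_self _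
  -- Subadditivity over this cover yields the lower bound without measurability of either event.
  have hcover : Set.univ ⊆ {x | ¬ (t • (1 : Matrix (Fin (2 * M + 1)) (Fin (2 * M + 1)) ℂ) +
        ∑ k, centredSampleTerm ω μ (τ k x)).PosSemidef} ∪ {x |
        (gramR ω fun k => τ k x).PosDef ∧
        ((lambdaMin (expectedGram P ω τ) - t)⁻¹ •
            (1 : Matrix (Fin (2 * M + 1)) (Fin (2 * M + 1)) ℂ) -
          (gramR ω fun k => τ k x)⁻¹).PosSemidef} := by
    intro x _
    by_cases hx : (t • (1 : Matrix (Fin (2 * M + 1)) (Fin (2 * M + 1)) ℂ) +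
        ∑ k, centredSampleTerm ω μ (τ k x)).PosSemidef
    · refine Or.inr (Matrix.posDef_and_posSemidef_inv_of_posSemidef_sub (sub_pos.mpr htl) ?_)
      -- $R_N-(\lambda_{\min}(R_0)-t)I=(R_0-\lambda_{\min}(R_0)I)+(tI+\sum_kX_k)$.
      have := hherm.posSemidef_sub_lambdaMin_smul_one.add hx
      convert this using 1
      rw [hgram]
      module
    · exact Or.inl hx
  have h1 := (measureReal_mono (μ := P) hcover).trans (measureReal_union_le _ _)
  rw [probReal_univ] at h1
  linarith
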